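/- Let $P$ be a finite set of points in the plane such that no two distinct points of $P$ lie on a line whose angle with the $x$-axis is a multiple of $\pi/3$. For each $u\in P$, the rays from $u$ at angles $k\pi/3$ ($0\le k\le 5$) divide the plane into six cones with apex $u$. The cones starting (counter-clockwise) at the angles $\pi/3,\pi,5\pi/3$ are called positive and the other three negative. Distances from $u$ inside a cone are compared by orthogonal projection onto the bisector of the cone. The half-$\theta_6$-graph of $P$ has vertex set $P$ and joins each $u\in P$ to the closest point of $P$ (in this sense) in each of its positive cones containing a point of $P$. For $s\in P$ and a negative cone $C$ of $s$, the canonical path of $s$ in $C$ consists of the edges between consecutive (in angular order around $s$) neighbours of $s$ in $C$. The graph $G_9$ is the subgraph of the half-$\theta_6$-graph that contains, for each $s\in P$ and each negative cone $C$ of $s$ in which $s$ has a neighbour, the edge from $s$ to its closest neighbour in $C$ and the edges of the canonical path of $s$ in $C$. All edges are weighted by Euclidean length, and $d_G(u,v)$ denotes the length of a shortest path from $u$ to $v$ in $G$. **Theorem.** $G_9$ is a $3$-spanner of the half-$\theta_6$-graph, that is, it is a subgraph of the half-$\theta_6$-graph and $d_{G_9}(u,v)\le 3\,d_{\text{half-}\theta_6}(u,v)$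 for all $u,v\in P$. Moreover, let $sv$ be an edge of the half-$\theta_6$-graph with $v$ in a negative cone $C$ of $s$. Then the approximation path of $sv$, which consists of the edge from $s$ to its closest neighbour $c$ in $C$ followed by the part of the canonical path of $s$ in $C$ between $c$ and $v$, exists in $G_9$; it has length at most $3|sv|$, and its part from $c$ to $v$ on the canonical path has length at most $2|sv|$. -/

import Mathlib

open scoped NNReal ENNReal

namespace HalfTheta

noncomputable section

/-- The Euclidean plane. -/
abbrev Plane : Type := EuclideanSpace ℝ (Fin 2)

/-- The unit vector at counter-clockwise angle `θ` from the positive `x`-axis. -/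
def unitVec (θ : ℝ) : Plane := !₂[Real.cos θ, Real.sin θ]

/-- The direction of the `k`-th cone boundary ray, at angle `k π / 3`. -/
def ray (k : ℕ) : Plane := unitVec (k * (Real.pi / 3))

/-- The cone with apex `u` between the rays at angles `k π / 3` and `(k + 1) π / 3`. The first ray
(without the apex) belongs to it, the second does not, so that the six cones `k = 0, …, 5`
partition the plane without `u`. -/
def sector (k : ℕ) (u : Plane) : Set Plane :=
  {v | ∃ a b : ℝ, 0 < a ∧ 0 ≤ b ∧ v = u + a • ray k + b • ray (k + 1)}

/-- Signed length of the projection of `v - u` on the bisector of `sector k u`. -/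
def proj (k : ℕ) (u v : Plane) : ℝ :=
  inner ℝ (v - u) (unitVec (k * (Real.pi / 3) + Real.pi / 6))

/-- Index of the positive cone `C i`: `C 0`, `C 1`, `C 2` start at angles `π/3`, `π`, `5π/3`. -/
def posIdx (i : Fin 3) : ℕ := 2 * i.val + 1

/-- Index of the negative cone opposite to `C i`, which starts at an angle larger by `π`
(the angles are understood modulo `2π`). -/
def negIdx (i : Fin 3) : ℕ := 2 * i.val + 4

/-- No two distinct points of `P` lie on a line parallel to a cone boundary. -/
def GeneralPosition (P : Finset Plane) : Prop :=
  ∀ u ∈ P, ∀ v ∈ P, u ≠ v → ∀ (k : ℕ) (r : ℝ), v - u ≠ r • ray k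

/-- `v` is the closest vertex to `u` in the positive cone `C i` of `u`. -/
def IsPosClosest (P : Finset Plane) (u : P) (i : Fin 3) (v : P) : Prop :=
  v.1 ∈ sector (posIdx i) u ∧
    ∀ w : P, w.1 ∈ sector (posIdx i) u → proj (posIdx i) u v ≤ proj (posIdx i) u w

/-- The half-θ₆-graph of `P`: each vertex is joined to the closest vertex in each of its positive
cones. -/
def halfTheta6 (P : Finset Plane) : SimpleGraph P :=
  SimpleGraph.fromRel fun u v => ∃ i, IsPosClosest P u i v

/-- The neighbours of `s` in the half-θ₆-graph that lie in the `i`-th negative cone of `s`. -/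
def negNbrs (P : Finset Plane) (s : P) (i : Fin 3) : Set P :=
  {v | (halfTheta6 P).Adj s v ∧ v.1 ∈ sector (negIdx i) s}

/-- `c` is closest to `s` among the neighbours of `s` in its `i`-th negative cone. -/
def IsNegClosest (P : Finset Plane) (s : P) (i : Fin 3) (c : P) : Prop :=
  c ∈ negNbrs P s i ∧ ∀ w ∈ negNbrs P s i, proj (negIdx i) s c ≤ proj (negIdx i) s w

/-- Seen from `s`, the direction of `w` is obtained from that of `v` by a counter-clockwise turn by
an angle strictly between `0` and `π`. Inside one cone this is the angular order around `s`. -/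
def CCW (s v w : Plane) : Prop :=
  0 < (v - s) 0 * (w - s) 1 - (v - s) 1 * (w - s) 0

/-- `v` and `w` are neighbours of `s` in the `i`-th negative cone of `s`, and `w` comes next after
`v` in the counter-clockwise order around `s` of all these neighbours. -/
def Consecutive (P : Finset Plane) (s : P) (i : Fin 3) (v w : P) : Prop :=
  v ∈ negNbrs P s i ∧ w ∈ negNbrs P s i ∧ CCW s v w ∧
    ∀ x ∈ negNbrs P s i, ¬ (CCW s v x ∧ CCW s x w)

/-- The canonical path of `s` in its `i`-th negative cone: the edges of the half-θ₆-graph between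
consecutive neighbours of `s` in that cone. -/
def canonicalPath (P : Finset Plane) (s : P) (i : Fin 3) : SimpleGraph P :=
  halfTheta6 P ⊓ SimpleGraph.fromRel (Consecutive P s i)

/-- The graph `G₉`: for each vertex `s` and each negative cone of `s`, it keeps the edge from `s` to
its closest neighbour in the cone, and the edges of the canonical path in the cone. -/
def G9 (P : Finset Plane) : SimpleGraph P :=
  SimpleGraph.fromRel (fun s c => ∃ i, IsNegClosest P s i c) ⊔ ⨆ s, ⨆ i, canonicalPath P s i

/-- The length of a walk: the sum of the lengths of its edges. -/
def walkLength {V : Type*} [PseudoMetricSpace V] {G : SimpleGraph V} {u v : V}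
    (p : G.Walk u v) : ℝ :=
  (p.darts.map fun d => dist d.fst d.snd).sum

/-- The weighted graph distance `d_G(u, v)`, which is `∞` if no path joins `u` and `v`. -/
def graphDist {V : Type*} [PseudoMetricSpace V] (G : SimpleGraph V) (u v : V) : ℝ≥0∞ :=
  ⨅ p : G.Walk u v, ENNReal.ofReal (walkLength p)

/-- `H` is a `t`-spanner of `G`. -/
def IsSpanner {V : Type*} [PseudoMetricSpace V] (t : ℝ≥0) (H G : SimpleGraph V) : Prop :=
  1 ≤ t ∧ H ≤ G ∧ ∀ u v : V, graphDist H u v ≤ t * graphDist G u v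

/-- `p` is the approximation path in `G₉` for a vertex `v` in the `i`-th negative cone of `s`: the
edge from `s` to its closest neighbour `c` in this cone, followed by the path from `c` to `v`
along the edges of the canonical path in this cone. -/
def IsApproximationPath (P : Finset Plane) (i : Fin 3) {s v : P} (p : (G9 P).Walk s v) : Prop :=
  ∃ (c : P) (h : (G9 P).Adj s c) (q : (G9 P).Walk c v),
    p = SimpleGraph.Walk.cons h q ∧ IsNegClosest P s i c ∧ q.IsPath ∧
      ∀ e ∈ q.edges, e ∈ (canonicalPath P s i).edgeSet

end

end HalfTheta

/-
In a negative cone of `s` use the oblique coordinates `x`, `y` along its two boundary rays. The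
neighbours of `s` in the cone form an antichain for the product order, so going around `s` means
that `x` decreases while `y` increases. Two consecutive neighbours are adjacent, because a point
obstructing this edge that is extremal in the direction of the bisector would be a neighbour of `s`
between them. Hence an edge of the canonical path has length at most the increase of `y - x` along
it, and these increases telescope. If `v` and the closest neighbour `c` have coordinates `(a, b)`
and `(a₀, b₀)` relative to `s`, then `a₀ + b₀ ≤ a + b`, and both bounds follow from
`3 a + b ≤ 3 |sv|` and `a + 3 b ≤ 3 |sv|`, where `|sv|² = a² + a b + b²`.
-/

namespace HalfTheta

open SimpleGraph hiding dist dist_comm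

section Walk

variable {V : Type*} {G : SimpleGraph V}

lemma forall_darts_rel_or_forall_darts_swap {r : V → V → Prop} (hr : Relator.BiUnique r) {u v : V}
    {q : G.Walk u v} (hq : q.IsPath) (h : ∀ d ∈ q.darts, r d.fst d.snd ∨ r d.snd d.fst) :
    (∀ d ∈ q.darts, r d.fst d.snd) ∨ ∀ d ∈ q.darts, r d.snd d.fst := by
  induction q with
  | nil => simp
  | @cons u y v huy q ih =>
    obtain ⟨hq, hu⟩ := (Walk.cons_isPath_iff huy q).1 hq
    simp only [Walk.darts_cons, List.forall_mem_cons] at h ⊢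
    specialize ih hq h.2
    cases q with
    | nil => simpa using h.1
    | @cons _ z _ hyz q =>
      have hzu : z ≠ u := by
        rintro rfl
        simp at hu
      simp only [Walk.darts_cons, List.forall_mem_cons] at ih ⊢
      rcases h.1, ih with ⟨h1 | h1, ih | ih⟩
      · exact Or.inl ⟨h1, ih⟩
      · exact absurd (hr.1 ih.1 h1) hzu
      · exact absurd (hr.2 ih.1 h1) hzu
      · exact Or.inr ⟨h1, ih⟩

variable [PseudoMetricSpace V]

lemma walkLength_nil {u : V} : walkLength (Walk.nil : G.Walk u u) = 0 := by
  simp [walkLength]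

lemma walkLength_cons {u v w : V} (h : G.Adj u v) (p : G.Walk v w) :
    walkLength (Walk.cons h p) = dist u v + walkLength p := by
  simp [walkLength]

lemma walkLength_append {u v w : V} (p : G.Walk u v) (q : G.Walk v w) :
    walkLength (p.append q) = walkLength p + walkLength q := by
  simp [walkLength]

lemma walkLength_reverse {u v : V} (p : G.Walk u v) : walkLength p.reverse = walkLength p := by
  simp [walkLength, Walk.darts_reverse, List.sum_reverse, Function.comp_def, dist_comm]

lemma walkLength_le_sub {f : V → ℝ} {u v : V} (q : G.Walk u v)
    (h : ∀ d ∈ q.darts, dist d.fst d.snd ≤ f d.snd - f d.fst) : walkLength q ≤ f v - f u := by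
  induction q with
  | nil => simp [walkLength_nil]
  | cons huy q ih =>
    simp only [Walk.darts_cons, List.forall_mem_cons] at h
    rw [walkLength_cons]
    linarith [ih h.2, h.1]

lemma walkLength_le_abs_sub {r : V → V → Prop} (hr : Relator.BiUnique r) {f : V → ℝ}
    (hf : ∀ x y, r x y → dist x y ≤ f y - f x) {u v : V} {q : G.Walk u v} (hq : q.IsPath)
    (h : ∀ d ∈ q.darts, r d.fst d.snd ∨ r d.snd d.fst) : walkLength q ≤ |f v - f u| := by
  rcases forall_darts_rel_or_forall_darts_swap hr hq h with h | h
  · exact (walkLength_le_sub q fun d hd => hf _ _ (h d hd)).trans (le_abs_self _)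
  · refine (walkLength_le_sub (f := -f) q fun d hd => ?_).trans ?_
    · have := hf _ _ (h d hd)
      rw [dist_comm, Pi.neg_apply, Pi.neg_apply]
      linarith
    · rw [Pi.neg_apply, Pi.neg_apply, neg_sub_neg, ← neg_sub]
      exact neg_le_abs _

lemma exists_walkLength_le_mul {H : SimpleGraph V} {t : ℝ}
    (h : ∀ u v, G.Adj u v → ∃ p : H.Walk u v, walkLength p ≤ t * dist u v) {u v : V}
    (q : G.Walk u v) : ∃ p : H.Walk u v, walkLength p ≤ t * walkLength q := by
  induction q with
  | nil => exact ⟨.nil, by simp [walkLength_nil]⟩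
  | cons huy q ih =>
    obtain ⟨p, hp⟩ := h _ _ huy
    obtain ⟨p', hp'⟩ := ih
    refine ⟨p.append p', ?_⟩
    rw [walkLength_append, walkLength_cons, mul_add]
    exact add_le_add hp hp'

lemma isSpanner_of_forall_adj {t : ℝ≥0} {H : SimpleGraph V} (ht : 1 ≤ t) (hle : H ≤ G)
    (h : ∀ u v, G.Adj u v → ∃ p : H.Walk u v, walkLength p ≤ t * dist u v) : IsSpanner t H G := by
  refine ⟨ht, hle, fun u v => ?_⟩
  rw [graphDist, graphDist, ENNReal.mul_iInf_of_ne (by positivity) (by simp)]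
  refine le_iInf fun q => ?_
  obtain ⟨p, hp⟩ := exists_walkLength_le_mul h q
  calc ⨅ p : H.Walk u v, ENNReal.ofReal (walkLength p)
      ≤ ENNReal.ofReal (walkLength p) := iInf_le _ p
    _ ≤ ENNReal.ofReal (t * walkLength q) := ENNReal.ofReal_le_ofReal hp
    _ = t * ENNReal.ofReal (walkLength q) := by
      rw [ENNReal.ofReal_mul t.coe_nonneg, ENNReal.ofReal_coe_nnreal]

end Walk

section Coordinates

lemma unitVec_add_pi (θ : ℝ) : unitVec (θ + Real.pi) = -unitVec θ := by
  ext j; fin_cases j <;> simp [unitVec]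

lemma unitVec_eq_of_modEq {k l : ℕ} (h : k ≡ l [MOD 6]) (θ : ℝ) :
    unitVec (k * (Real.pi / 3) + θ) = unitVec (l * (Real.pi / 3) + θ) := by
  obtain ⟨n, hn⟩ := (Nat.modEq_iff_dvd).1 h
  have hl : (l : ℝ) * (Real.pi / 3) + θ = k * (Real.pi / 3) + θ + n * (2 * Real.pi) := by
    have : (l : ℝ) - k = 6 * n := by exact_mod_cast hn
    linear_combination (Real.pi / 3) * this
  rw [hl, unitVec, unitVec, Real.cos_add_int_mul_two_pi, Real.sin_add_int_mul_two_pi]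

lemma inner_unitVec (α β : ℝ) : inner ℝ (unitVec α) (unitVec β) = Real.cos (α - β) := by
  simp only [unitVec, PiLp.inner_apply, RCLike.inner_apply, Real.ringHom_apply, Fin.sum_univ_two,
    Matrix.cons_val_zero, Matrix.cons_val_one, Matrix.cons_val_fin_one, Real.cos_sub]
  ring

lemma norm_unitVec (θ : ℝ) : ‖unitVec θ‖ = 1 := by
  rw [← sq_eq_sq₀ (norm_nonneg _) zero_le_one, ← real_inner_self_eq_norm_sq, inner_unitVec]
  simp

lemma unitVec_sub_add_unitVec_add (θ φ : ℝ) :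
    unitVec (θ - φ) + unitVec (θ + φ) = (2 * Real.cos φ) • unitVec θ := by
  ext j
  fin_cases j <;>
    simp only [unitVec, Fin.zero_eta, Fin.mk_one, PiLp.add_apply, PiLp.smul_apply, smul_eq_mul,
      Matrix.cons_val_zero, Matrix.cons_val_one, Matrix.cons_val_fin_one, Real.cos_sub,
      Real.cos_add, Real.sin_sub, Real.sin_add] <;>
    ring

lemma ray_add_three (k : ℕ) : ray (k + 3) = -ray k := by
  rw [ray, ray, ← unitVec_add_pi]
  congr 1
  push_cast
  ring

lemma negIdx_eq_posIdx_add_three (i : Fin 3) : negIdx i = posIdx i + 3 := rfl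

/-- The unit vector along the bisector of the positive cone `C i`. -/
noncomputable def bisector (i : Fin 3) : Plane := unitVec (posIdx i * (Real.pi / 3) + Real.pi / 6)

lemma bisector_add_one (i : Fin 3) :
    bisector (i + 1) = unitVec (negIdx i * (Real.pi / 3) - Real.pi / 6) := by
  have h : posIdx (i + 1) + 1 ≡ negIdx i [MOD 6] := by decide +revert
  rw [sub_eq_add_neg, ← unitVec_eq_of_modEq h, bisector]
  congr 1
  push_cast
  ring

lemma bisector_add_two (i : Fin 3) :
    bisector (i + 2) = unitVec (negIdx i * (Real.pi / 3) + Real.pi / 2) := by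
  have h : posIdx (i + 2) ≡ negIdx i + 1 [MOD 6] := by decide +revert
  rw [bisector, unitVec_eq_of_modEq h]
  congr 1
  push_cast
  ring

lemma neg_bisector (i : Fin 3) :
    -bisector i = unitVec (negIdx i * (Real.pi / 3) + Real.pi / 6) := by
  rw [bisector, negIdx_eq_posIdx_add_three, ← unitVec_add_pi]
  congr 1
  push_cast
  ring

lemma bisector_add_bisector_add_bisector (i : Fin 3) :
    bisector i + bisector (i + 1) + bisector (i + 2) = 0 := by
  rw [add_assoc, add_eq_zero_iff_neg_eq, neg_bisector, bisector_add_one, bisector_add_two]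
  set θ := negIdx i * (Real.pi / 3) + Real.pi / 6 with hθ
  have h := unitVec_sub_add_unitVec_add θ (Real.pi / 3)
  rw [Real.cos_pi_div_three, mul_one_div_cancel two_ne_zero, one_smul] at h
  rw [← h]
  congr 2 <;> rw [hθ] <;> ring

/-- The projection on the bisector of `C i`, scaled so that for every `i` the coordinates
`coord (i + 1)` and `coord (i + 2)` are the oblique coordinates along the two boundary rays of the
`i`-th negative cone. -/
noncomputable def coord (i : Fin 3) : Plane →ₗ[ℝ] ℝ := (2 / √3) • innerₛₗ ℝ (bisector i)

lemma coord_apply (i : Fin 3) (p : Plane) : coord i p = 2 / √3 * inner ℝ (bisector i) p := rfl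

lemma coord_add_coord_add_coord (i : Fin 3) (p : Plane) :
    coord i p + coord (i + 1) p + coord (i + 2) p = 0 := by
  rw [coord_apply, coord_apply, coord_apply, ← mul_add, ← mul_add, ← inner_add_left,
    ← inner_add_left, bisector_add_bisector_add_bisector, inner_zero_left, mul_zero]

lemma proj_posIdx (i : Fin 3) (u v : Plane) :
    proj (posIdx i) u v = √3 / 2 * (coord i v - coord i u) := by
  rw [← map_sub, coord_apply, proj, real_inner_comm, bisector]
  field_simp

lemma proj_negIdx (i : Fin 3) (u v : Plane) :
    proj (negIdx i) u v = √3 / 2 * (coord i u - coord i v) := by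
  rw [← map_sub, coord_apply, proj, ← neg_bisector, inner_neg_right, ← inner_neg_left, neg_sub,
    real_inner_comm]
  field_simp

lemma coord_add_one_combination (i : Fin 3) (a b : ℝ) :
    coord (i + 1) (a • ray (negIdx i) + b • ray (negIdx i + 1)) = a := by
  have h₁ : inner ℝ (bisector (i + 1)) (ray (negIdx i)) = √3 / 2 := by
    rw [bisector_add_one, ray, inner_unitVec, ← Real.cos_pi_div_six, ← Real.cos_neg (Real.pi / 6)]
    ring_nf
  have h₂ : inner ℝ (bisector (i + 1)) (ray (negIdx i + 1)) = 0 := by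
    rw [bisector_add_one, ray, inner_unitVec, ← Real.cos_pi_div_two, ← Real.cos_neg (Real.pi / 2)]
    push_cast
    ring_nf
  rw [coord_apply, inner_add_right, inner_smul_right, inner_smul_right, h₁, h₂]
  field_simp
  ring

lemma coord_add_two_combination (i : Fin 3) (a b : ℝ) :
    coord (i + 2) (a • ray (negIdx i) + b • ray (negIdx i + 1)) = b := by
  have h₁ : inner ℝ (bisector (i + 2)) (ray (negIdx i)) = 0 := by
    rw [bisector_add_two, ray, inner_unitVec, ← Real.cos_pi_div_two]
    ring_nf
  have h₂ : inner ℝ (bisector (i + 2)) (ray (negIdx i + 1)) = √3 / 2 := by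
    rw [bisector_add_two, ray, inner_unitVec, ← Real.cos_pi_div_six]
    push_cast
    ring_nf
  rw [coord_apply, inner_add_right, inner_smul_right, inner_smul_right, h₁, h₂]
  field_simp
  ring

lemma ray_cross_ray_succ (k : ℕ) : ray k 0 * ray (k + 1) 1 - ray k 1 * ray (k + 1) 0 = √3 / 2 := by
  have h : ((k + 1 : ℕ) : ℝ) * (Real.pi / 3) - k * (Real.pi / 3) = Real.pi / 3 := by
    push_cast
    ring
  rw [← Real.sin_pi_div_three, ← h, Real.sin_sub]
  simp only [ray, unitVec, Matrix.cons_val_zero, Matrix.cons_val_one, Matrix.cons_val_fin_one]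
  ring

lemma exists_eq_combination (k : ℕ) (p : Plane) : ∃ a b : ℝ, p = a • ray k + b • ray (k + 1) := by
  have h := ray_cross_ray_succ k
  have h3 : √3 ≠ 0 := by positivity
  refine ⟨2 / √3 * (p 0 * ray (k + 1) 1 - p 1 * ray (k + 1) 0),
    2 / √3 * (ray k 0 * p 1 - ray k 1 * p 0), ?_⟩
  ext j
  fin_cases j <;>
    simp only [Fin.zero_eta, Fin.mk_one, PiLp.add_apply, PiLp.smul_apply, smul_eq_mul] <;>
    field_simp
  · linear_combination (-2 * p 0) * h
  · linear_combination (-2 * p 1) * h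

lemma eq_combination (i : Fin 3) (p : Plane) :
    p = coord (i + 1) p • ray (negIdx i) + coord (i + 2) p • ray (negIdx i + 1) := by
  obtain ⟨a, b, rfl⟩ := exists_eq_combination (negIdx i) p
  rw [coord_add_one_combination, coord_add_two_combination]

lemma fin_three_add_one_add_one (i : Fin 3) : i + 1 + 1 = i + 2 := by
  decide +revert

lemma fin_three_add_one_add_two (i : Fin 3) : i + 1 + 2 = i := by
  decide +revert

lemma fin_three_add_two_add_one (i : Fin 3) : i + 2 + 1 = i := by
  decide +revert

lemma fin_three_add_two_add_two (i : Fin 3) : i + 2 + 2 = i + 1 := by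
  decide +revert

lemma mem_sector_negIdx_iff (i : Fin 3) (s v : Plane) :
    v ∈ sector (negIdx i) s ↔
      coord (i + 1) s < coord (i + 1) v ∧ coord (i + 2) s ≤ coord (i + 2) v := by
  rw [← sub_pos, ← sub_nonneg (b := coord (i + 2) s), ← map_sub, ← map_sub]
  constructor
  · rintro ⟨a, b, ha, hb, rfl⟩
    rw [add_assoc, add_sub_cancel_left, coord_add_one_combination, coord_add_two_combination]
    exact ⟨ha, hb⟩
  · rintro ⟨ha, hb⟩
    exact ⟨_, _, ha, hb, by rw [add_assoc, ← eq_combination, add_sub_cancel]⟩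

lemma mem_sector_add_three_iff (k : ℕ) (u v : Plane) : v ∈ sector (k + 3) u ↔ u ∈ sector k v := by
  have h : k + 3 + 1 = k + 1 + 3 := by ring
  simp only [sector, Set.mem_ofPred_eq, h, ray_add_three]
  refine exists_congr fun a => exists_congr fun b => and_congr_right fun _ =>
    and_congr_right fun _ => ⟨?_, ?_⟩ <;> rintro rfl <;> module

lemma mem_sector_posIdx_iff_mem_sector_negIdx (i : Fin 3) (u v : Plane) :
    v ∈ sector (posIdx i) u ↔ u ∈ sector (negIdx i) v :=
  (mem_sector_add_three_iff (posIdx i) v u).symm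

lemma notMem_sector_negIdx_self (i : Fin 3) (s : Plane) : s ∉ sector (negIdx i) s := fun h =>
  lt_irrefl _ ((mem_sector_negIdx_iff i s s).1 h).1

lemma eq_of_mem_sector_negIdx {i j : Fin 3} {s v : Plane} (hi : v ∈ sector (negIdx i) s)
    (hj : v ∈ sector (negIdx j) s) : i = j := by
  obtain ⟨hi₁, hi₂⟩ := (mem_sector_negIdx_iff i s v).1 hi
  obtain ⟨hj₁, hj₂⟩ := (mem_sector_negIdx_iff j s v).1 hj
  have hs := coord_add_coord_add_coord i s
  have hv := coord_add_coord_add_coord i v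
  obtain rfl | rfl | rfl : j = i ∨ j = i + 1 ∨ j = i + 2 := by omega
  · rfl
  · rw [fin_three_add_one_add_two] at hj₂
    linarith
  · rw [fin_three_add_two_add_one] at hj₁
    linarith

lemma disjoint_sector_negIdx_sector_posIdx (i j : Fin 3) (s : Plane) :
    Disjoint (sector (negIdx i) s) (sector (posIdx j) s) := by
  refine Set.disjoint_left.2 fun v hi hj => ?_
  rw [mem_sector_posIdx_iff_mem_sector_negIdx] at hj
  obtain ⟨hi₁, hi₂⟩ := (mem_sector_negIdx_iff i s v).1 hi
  obtain ⟨hj₁, hj₂⟩ := (mem_sector_negIdx_iff j v s).1 hj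
  have hs := coord_add_coord_add_coord i s
  have hv := coord_add_coord_add_coord i v
  obtain rfl | rfl | rfl : j = i ∨ j = i + 1 ∨ j = i + 2 := by omega
  · linarith
  · rw [fin_three_add_one_add_one] at hj₁
    linarith
  · rw [fin_three_add_two_add_two] at hj₂
    linarith

lemma ccw_iff_coord (i : Fin 3) (s v w : Plane) :
    CCW s v w ↔ (coord (i + 2) v - coord (i + 2) s) * (coord (i + 1) w - coord (i + 1) s) <
      (coord (i + 1) v - coord (i + 1) s) * (coord (i + 2) w - coord (i + 2) s) := by
  have h3 : 0 < √3 / 2 := by positivity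
  have hcross : (v - s) 0 * (w - s) 1 - (v - s) 1 * (w - s) 0 = √3 / 2 *
      ((coord (i + 1) v - coord (i + 1) s) * (coord (i + 2) w - coord (i + 2) s) -
        (coord (i + 2) v - coord (i + 2) s) * (coord (i + 1) w - coord (i + 1) s)) := by
    rw [eq_combination i (v - s), eq_combination i (w - s), ← ray_cross_ray_succ (negIdx i)]
    simp only [map_sub, PiLp.add_apply, PiLp.smul_apply, smul_eq_mul]
    ring
  rw [CCW, hcross, mul_pos_iff_of_pos_left h3, sub_pos]

lemma norm_sq_eq_coord (i : Fin 3) (p : Plane) :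
    ‖p‖ ^ 2 = coord (i + 1) p ^ 2 + coord (i + 1) p * coord (i + 2) p + coord (i + 2) p ^ 2 := by
  have h (k : ℕ) : inner ℝ (ray k) (ray (k + 1)) = 1 / 2 := by
    rw [ray, ray, inner_unitVec, ← Real.cos_pi_div_three, ← Real.cos_neg (Real.pi / 3)]
    push_cast
    ring_nf
  conv_lhs => rw [eq_combination i p]
  rw [norm_add_sq_real, norm_smul, norm_smul, inner_smul_left, inner_smul_right, h, ray, ray,
    norm_unitVec, norm_unitVec, mul_one, mul_one, Real.norm_eq_abs, Real.norm_eq_abs, sq_abs,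
    sq_abs, conj_trivial]
  ring

lemma norm_le_abs_coord_add_abs_coord (i : Fin 3) (p : Plane) :
    ‖p‖ ≤ |coord (i + 1) p| + |coord (i + 2) p| := by
  conv_lhs => rw [eq_combination i p]
  refine (norm_add_le _ _).trans_eq ?_
  rw [norm_smul, norm_smul, ray, ray, norm_unitVec, norm_unitVec, mul_one, mul_one,
    Real.norm_eq_abs, Real.norm_eq_abs]

lemma dist_le_abs_coord_sub_add_abs_coord_sub (i : Fin 3) (p q : Plane) :
    dist p q ≤ |coord (i + 1) q - coord (i + 1) p| + |coord (i + 2) q - coord (i + 2) p| := by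
  rw [dist_comm, dist_eq_norm, ← map_sub, ← map_sub]
  exact norm_le_abs_coord_add_abs_coord i _

lemma dist_sq_eq_coord (i : Fin 3) (p q : Plane) :
    dist p q ^ 2 = (coord (i + 1) q - coord (i + 1) p) ^ 2 +
      (coord (i + 1) q - coord (i + 1) p) * (coord (i + 2) q - coord (i + 2) p) +
      (coord (i + 2) q - coord (i + 2) p) ^ 2 := by
  rw [dist_comm, dist_eq_norm, norm_sq_eq_coord i, map_sub, map_sub]

end Coordinates

section NegativeCone

variable {P : Finset Plane} {s v w c : P} {i : Fin 3}

lemma halfTheta6_adj_iff :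
    (halfTheta6 P).Adj v w ↔ ∃ i, IsPosClosest P v i w ∨ IsPosClosest P w i v := by
  rw [halfTheta6, fromRel_adj, ← exists_or]
  refine and_iff_right_of_imp ?_
  rintro ⟨i, h⟩ rfl
  exact notMem_sector_negIdx_self i _
    ((mem_sector_posIdx_iff_mem_sector_negIdx i _ _).1 (h.elim And.left And.left))

lemma mem_negNbrs_iff_isPosClosest : v ∈ negNbrs P s i ↔ IsPosClosest P v i s := by
  constructor
  · rintro ⟨hadj, hv⟩
    obtain ⟨j, h | h⟩ := halfTheta6_adj_iff.1 hadj
    · exact absurd h.1 (Set.disjoint_left.1 (disjoint_sector_negIdx_sector_posIdx i j s) hv)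
    · rwa [eq_of_mem_sector_negIdx hv ((mem_sector_posIdx_iff_mem_sector_negIdx j _ _).1 h.1)]
  · intro h
    exact ⟨halfTheta6_adj_iff.2 ⟨i, Or.inr h⟩,
      (mem_sector_posIdx_iff_mem_sector_negIdx i _ _).1 h.1⟩

lemma exists_mem_negNbrs_or_mem_negNbrs (h : (halfTheta6 P).Adj v w) :
    ∃ i, w ∈ negNbrs P v i ∨ v ∈ negNbrs P w i := by
  obtain ⟨i, h⟩ := halfTheta6_adj_iff.1 h
  exact ⟨i, h.symm.imp mem_negNbrs_iff_isPosClosest.2 mem_negNbrs_iff_isPosClosest.2⟩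

lemma GeneralPosition.coord_injective (hP : GeneralPosition P) (j : Fin 3) :
    Function.Injective fun u : P => coord j u := by
  intro u v h
  by_contra hne
  refine hP u u.2 v v.2 (Subtype.coe_ne_coe.2 hne) (negIdx (j + 2) + 1) (coord (j + 1) (v - u)) ?_
  have hj : coord j (v - u : Plane) = 0 := by rw [map_sub, sub_eq_zero]; exact h.symm
  conv_lhs => rw [eq_combination (j + 2) (v - u)]
  rw [fin_three_add_two_add_one, fin_three_add_two_add_two, hj, zero_smul, zero_add]

lemma mem_sector_negIdx_iff_lt (hP : GeneralPosition P) :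
    v.1 ∈ sector (negIdx i) s ↔
      coord (i + 1) s < coord (i + 1) v ∧ coord (i + 2) s < coord (i + 2) v := by
  rw [mem_sector_negIdx_iff]
  refine and_congr_right fun h => ⟨fun h' => h'.lt_of_ne ?_, le_of_lt⟩
  refine (hP.coord_injective (i + 2)).ne ?_
  rintro rfl
  exact lt_irrefl _ h

lemma isPosClosest_iff (hP : GeneralPosition P) :
    IsPosClosest P v i s ↔
      (coord (i + 1) s < coord (i + 1) v ∧ coord (i + 2) s < coord (i + 2) v) ∧
      ∀ u : P, coord (i + 1) u < coord (i + 1) v → coord (i + 2) u < coord (i + 2) v →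
        coord i s ≤ coord i u := by
  have h3 : 0 < √3 / 2 := by positivity
  simp only [IsPosClosest, mem_sector_posIdx_iff_mem_sector_negIdx, mem_sector_negIdx_iff_lt hP,
    proj_posIdx, mul_le_mul_iff_right₀ h3, sub_le_sub_iff_right, and_imp]

lemma mem_negNbrs_iff (hP : GeneralPosition P) :
    v ∈ negNbrs P s i ↔
      (coord (i + 1) s < coord (i + 1) v ∧ coord (i + 2) s < coord (i + 2) v) ∧
      ∀ u : P, coord (i + 1) u < coord (i + 1) v → coord (i + 2) u < coord (i + 2) v →
        coord i s ≤ coord i u := by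
  rw [mem_negNbrs_iff_isPosClosest, isPosClosest_iff hP]

lemma IsNegClosest.coord_le (hc : IsNegClosest P s i c) (hv : v ∈ negNbrs P s i) :
    coord i v ≤ coord i c := by
  have h3 : 0 < √3 / 2 := by positivity
  have h := hc.2 v hv
  rwa [proj_negIdx, proj_negIdx, mul_le_mul_iff_right₀ h3, sub_le_sub_iff_left] at h

lemma coord_lt_of_mem_negNbrs (hP : GeneralPosition P) (hv : v ∈ negNbrs P s i) :
    coord i v < coord i s := by
  obtain ⟨h₁, h₂⟩ := ((mem_negNbrs_iff hP).1 hv).1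
  linarith [coord_add_coord_add_coord i s, coord_add_coord_add_coord i v]

lemma not_coord_lt_and_lt_of_mem_negNbrs (hP : GeneralPosition P) (hv : v ∈ negNbrs P s i)
    (hw : w ∈ negNbrs P s i) :
    ¬(coord (i + 1) v < coord (i + 1) w ∧ coord (i + 2) v < coord (i + 2) w) := fun h =>
  (coord_lt_of_mem_negNbrs hP hv).not_ge (((mem_negNbrs_iff hP).1 hw).2 v h.1 h.2)

lemma coord_add_one_lt_iff_of_mem_negNbrs (hP : GeneralPosition P) (hv : v ∈ negNbrs P s i)
    (hw : w ∈ negNbrs P s i) :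
    coord (i + 1) w < coord (i + 1) v ↔ coord (i + 2) v < coord (i + 2) w := by
  constructor
  · intro h
    refine (not_lt.1 fun h' => not_coord_lt_and_lt_of_mem_negNbrs hP hw hv ⟨h, h'⟩).lt_of_ne ?_
    exact (hP.coord_injective (i + 2)).ne (by rintro rfl; exact lt_irrefl _ h)
  · intro h
    refine (not_lt.1 fun h' => not_coord_lt_and_lt_of_mem_negNbrs hP hv hw ⟨h', h⟩).lt_of_ne ?_
    exact (hP.coord_injective (i + 1)).ne (by rintro rfl; exact lt_irrefl _ h)

lemma ccw_iff_coord_add_two_lt (hP : GeneralPosition P) (hv : v ∈ negNbrs P s i)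
    (hw : w ∈ negNbrs P s i) : CCW s v w ↔ coord (i + 2) v < coord (i + 2) w := by
  obtain ⟨hv₁, hv₂⟩ := ((mem_negNbrs_iff hP).1 hv).1
  obtain ⟨hw₁, -⟩ := ((mem_negNbrs_iff hP).1 hw).1
  rw [ccw_iff_coord i]
  constructor
  · contrapose!
    intro h
    have h' : coord (i + 1) v.1 ≤ coord (i + 1) w := by
      rwa [← not_lt, coord_add_one_lt_iff_of_mem_negNbrs hP hv hw, not_lt]
    rw [mul_comm]
    gcongr
  · intro h
    have h' := (coord_add_one_lt_iff_of_mem_negNbrs hP hv hw).2 h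
    rw [mul_comm]
    gcongr

end NegativeCone

section Consecutive

variable {P : Finset Plane} {s v w : P} {i : Fin 3}

lemma consecutive_iff (hP : GeneralPosition P) :
    Consecutive P s i v w ↔ v ∈ negNbrs P s i ∧ w ∈ negNbrs P s i ∧
      coord (i + 2) v < coord (i + 2) w ∧
      ∀ u ∈ negNbrs P s i, ¬(coord (i + 2) v < coord (i + 2) u ∧
        coord (i + 2) u < coord (i + 2) w) := by
  refine and_congr_right fun hv => and_congr_right fun hw =>
    and_congr (ccw_iff_coord_add_two_lt hP hv hw) (forall₂_congr fun u hu => ?_)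
  rw [ccw_iff_coord_add_two_lt hP hv hu, ccw_iff_coord_add_two_lt hP hu hw]

lemma biUnique_consecutive (hP : GeneralPosition P) (s : P) (i : Fin 3) :
    Relator.BiUnique (Consecutive P s i) := by
  constructor
  · intro v v' w h h'
    obtain ⟨hv, -, hvw, hno⟩ := (consecutive_iff hP).1 h
    obtain ⟨hv', -, hvw', hno'⟩ := (consecutive_iff hP).1 h'
    refine hP.coord_injective (i + 2) (le_antisymm ?_ ?_)
    · exact not_lt.1 fun hlt => hno' v hv ⟨hlt, hvw⟩
    · exact not_lt.1 fun hlt => hno v' hv' ⟨hlt, hvw'⟩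
  · intro v w w' h h'
    obtain ⟨-, hw, hvw, hno⟩ := (consecutive_iff hP).1 h
    obtain ⟨-, hw', hvw', hno'⟩ := (consecutive_iff hP).1 h'
    refine hP.coord_injective (i + 2) (le_antisymm ?_ ?_)
    · exact not_lt.1 fun hlt => hno w' hw' ⟨hvw', hlt⟩
    · exact not_lt.1 fun hlt => hno' w hw ⟨hvw, hlt⟩

lemma Consecutive.dist_le (hP : GeneralPosition P) (h : Consecutive P s i v w) :
    dist v w ≤ coord (i + 2) w - coord (i + 1) w - (coord (i + 2) v - coord (i + 1) v) := by
  obtain ⟨hv, hw, hlt, -⟩ := (consecutive_iff hP).1 h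
  have hlt' := (coord_add_one_lt_iff_of_mem_negNbrs hP hv hw).2 hlt
  calc dist v w
      ≤ |coord (i + 1) w - coord (i + 1) v| + |coord (i + 2) w - coord (i + 2) v| :=
        dist_le_abs_coord_sub_add_abs_coord_sub i v.1 w.1
    _ = coord (i + 2) w - coord (i + 1) w - (coord (i + 2) v - coord (i + 1) v) := by
      rw [abs_of_neg (sub_neg.2 hlt'), abs_of_pos (sub_pos.2 hlt)]
      ring

lemma Consecutive.coord_apex_le (hP : GeneralPosition P) (h : Consecutive P s i v w) {u : P}
    (hu₁ : coord (i + 1) u < coord (i + 1) v) (hu₂ : coord (i + 2) u < coord (i + 2) w) :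
    coord i s ≤ coord i u := by
  obtain ⟨hv, hw, -, hno⟩ := (consecutive_iff hP).1 h
  obtain ⟨⟨-, hsv⟩, hv⟩ := (mem_negNbrs_iff hP).1 hv
  obtain ⟨⟨hsw, -⟩, hw⟩ := (mem_negNbrs_iff hP).1 hw
  by_contra! hu
  obtain ⟨z, ⟨hz₁, hz₂, hz⟩, hmax⟩ := Set.exists_max_image
    {z : P | coord (i + 1) z < coord (i + 1) v ∧ coord (i + 2) z < coord (i + 2) w ∧
      coord i z < coord i s} (fun z => coord i z) (Set.toFinite _) ⟨u, hu₁, hu₂, hu⟩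
  have hwz : coord (i + 1) w < coord (i + 1) z := by
    refine (not_lt.1 fun h => hz.not_ge (hw z h hz₂)).lt_of_ne ((hP.coord_injective _).ne ?_)
    rintro rfl
    exact lt_irrefl _ hz₂
  have hvz : coord (i + 2) v < coord (i + 2) z := by
    refine (not_lt.1 fun h => hz.not_ge (hv z hz₁ h)).lt_of_ne ((hP.coord_injective _).ne ?_)
    rintro rfl
    exact lt_irrefl _ hz₁
  refine hno z ((mem_negNbrs_iff hP).2 ⟨⟨hsw.trans hwz, hsv.trans hvz⟩, fun y hy₁ hy₂ => ?_⟩)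
    ⟨hvz, hz₂⟩
  by_contra! hy
  have hyz := hmax y ⟨hy₁.trans hz₁, hy₂.trans hz₂, hy⟩
  linarith [coord_add_coord_add_coord i y, coord_add_coord_add_coord i z]

lemma Consecutive.adj (hP : GeneralPosition P) (h : Consecutive P s i v w) :
    (halfTheta6 P).Adj v w := by
  obtain ⟨hv, hw, hlt, -⟩ := (consecutive_iff hP).1 h
  have hlt' := (coord_add_one_lt_iff_of_mem_negNbrs hP hv hw).2 hlt
  have hsv := coord_lt_of_mem_negNbrs hP hv
  have hsw := coord_lt_of_mem_negNbrs hP hw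
  have hne : coord i v ≠ coord i w :=
    (hP.coord_injective i).ne (by rintro rfl; exact lt_irrefl _ hlt)
  rw [halfTheta6_adj_iff]
  rcases hne.lt_or_gt with h₀ | h₀
  · refine ⟨i + 1, Or.inr ((isPosClosest_iff hP).2 ?_)⟩
    rw [fin_three_add_one_add_one, fin_three_add_one_add_two]
    exact ⟨⟨hlt, h₀⟩, fun u hu₂ hu => not_lt.1 fun hu₁ =>
      (hu.trans hsw).not_ge (h.coord_apex_le hP hu₁ hu₂)⟩
  · refine ⟨i + 2, Or.inl ((isPosClosest_iff hP).2 ?_)⟩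
    rw [fin_three_add_two_add_one, fin_three_add_two_add_two]
    exact ⟨⟨h₀, hlt'⟩, fun u hu hu₁ => not_lt.1 fun hu₂ =>
      (hu.trans hsv).not_ge (h.coord_apex_le hP hu₁ hu₂)⟩

lemma canonicalPath_adj_iff (hP : GeneralPosition P) :
    (canonicalPath P s i).Adj v w ↔ Consecutive P s i v w ∨ Consecutive P s i w v := by
  rw [canonicalPath, inf_adj, fromRel_adj]
  refine ⟨fun h => h.2.2, fun h => ?_⟩
  have hadj := h.elim (Consecutive.adj hP) fun h => (h.adj hP).symm
  exact ⟨hadj, hadj.ne, h⟩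

lemma reachable_canonicalPath (hP : GeneralPosition P) (hv : v ∈ negNbrs P s i)
    (hw : w ∈ negNbrs P s i) : (canonicalPath P s i).Reachable v w := by
  classical
  let _ : LinearOrder (negNbrs P s i) := LinearOrder.lift' (fun x => coord (i + 2) x.1)
    ((hP.coord_injective (i + 2)).comp Subtype.val_injective)
  let _ : Fintype (negNbrs P s i) := Fintype.ofFinite _
  let _ : LocallyFiniteOrder (negNbrs P s i) := Fintype.toLocallyFiniteOrder
  have hcovBy (x y : negNbrs P s i) (h : x ⋖ y) : (canonicalPath P s i).Adj x y :=
    (canonicalPath_adj_iff hP).2 (Or.inl ((consecutive_iff hP).2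
      ⟨x.2, y.2, h.1, fun u hu hxy => h.2 (c := ⟨u, hu⟩) hxy.1 hxy.2⟩))
  have hle (x y : negNbrs P s i) (h : x ≤ y) : (canonicalPath P s i).Reachable x y :=
    (reachable_iff_reflTransGen _ _).2
      ((le_iff_reflTransGen_covBy.1 h).lift Subtype.val hcovBy)
  exact (le_total (⟨v, hv⟩ : negNbrs P s i) ⟨w, hw⟩).elim (hle _ _) fun h => (hle _ _ h).symm

end Consecutive

section ApproximationPath

variable {P : Finset Plane} {s v w c : P} {i : Fin 3}

lemma canonicalPath_le_G9 (s : P) (i : Fin 3) : canonicalPath P s i ≤ G9 P :=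
  (le_iSup₂_of_le (f := fun s i => canonicalPath P s i) s i le_rfl).trans le_sup_right

lemma IsNegClosest.adj (h : IsNegClosest P s i c) : (G9 P).Adj s c :=
  Or.inl ((fromRel_adj _ _ _).2 ⟨h.1.1.ne, Or.inl ⟨i, h⟩⟩)

lemma G9_le_halfTheta6 : G9 P ≤ halfTheta6 P := by
  refine sup_le (fun u v h => ?_) (iSup₂_le fun s i => inf_le_left)
  obtain ⟨-, ⟨i, h⟩ | ⟨i, h⟩⟩ := (fromRel_adj _ _ _).1 h
  · exact h.1.1
  · exact h.1.1.symm

lemma exists_isNegClosest (hv : v ∈ negNbrs P s i) : ∃ c, IsNegClosest P s i c :=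
  Set.exists_min_image (negNbrs P s i) (fun w => proj (negIdx i) s w) (Set.toFinite _) ⟨v, hv⟩

lemma exists_isApproximationPath (hP : GeneralPosition P) (hv : v ∈ negNbrs P s i) :
    ∃ p : (G9 P).Walk s v, IsApproximationPath P i p := by
  obtain ⟨c, hc⟩ := exists_isNegClosest hv
  obtain ⟨q, hq⟩ := (reachable_canonicalPath hP hc.1 hv).exists_isPath
  refine ⟨.cons hc.adj (q.mapLe (canonicalPath_le_G9 s i)), c, hc.adj, _, rfl, hc, hq.mapLe _, ?_⟩
  intro e he
  rw [Walk.edges_mapLe_eq_edges] at he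
  exact q.edges_subset_edgeSet he

lemma walkLength_le_of_subset_canonicalPath (hP : GeneralPosition P) {q : (G9 P).Walk c v}
    (hq : q.IsPath) (he : ∀ e ∈ q.edges, e ∈ (canonicalPath P s i).edgeSet) :
    walkLength q ≤
      |coord (i + 2) v - coord (i + 1) v - (coord (i + 2) c - coord (i + 1) c)| :=
  walkLength_le_abs_sub (biUnique_consecutive hP s i)
    (f := fun x => coord (i + 2) x - coord (i + 1) x) (fun _ _ h => h.dist_le hP) hq
    fun _ hd => (canonicalPath_adj_iff hP).1 (he _ (List.mem_map_of_mem hd))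

lemma three_mul_add_le {a b d : ℝ} (ha : 0 ≤ a) (hb : 0 ≤ b) (hd : 0 ≤ d)
    (hsq : d ^ 2 = a ^ 2 + a * b + b ^ 2) : 3 * a + b ≤ 3 * d := by
  refine le_of_sq_le_sq ?_ (by positivity)
  nlinarith [mul_nonneg ha hb]

lemma IsNegClosest.dist_add_walkLength_le (hP : GeneralPosition P) (hc : IsNegClosest P s i c)
    (hv : v ∈ negNbrs P s i) {q : (G9 P).Walk c v} (hq : q.IsPath)
    (he : ∀ e ∈ q.edges, e ∈ (canonicalPath P s i).edgeSet) :
    dist s c + walkLength q ≤ 3 * dist s v ∧ walkLength q ≤ 2 * dist s v := by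
  obtain ⟨hv₁, hv₂⟩ := ((mem_negNbrs_iff hP).1 hv).1
  obtain ⟨hc₁, hc₂⟩ := ((mem_negNbrs_iff hP).1 hc.1).1
  have hcv := hc.coord_le hv
  have hsum_c := coord_add_coord_add_coord i c
  have hsum_v := coord_add_coord_add_coord i v
  have hsc : dist s c ≤
      coord (i + 1) c - coord (i + 1) s + (coord (i + 2) c - coord (i + 2) s) := by
    have h := dist_le_abs_coord_sub_add_abs_coord_sub i s.1 c
    rwa [abs_of_pos (sub_pos.2 hc₁), abs_of_pos (sub_pos.2 hc₂)] at h
  have hsv := dist_sq_eq_coord i s.1 v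
  have ha := three_mul_add_le (sub_nonneg.2 hv₁.le) (sub_nonneg.2 hv₂.le) dist_nonneg hsv
  have hb := three_mul_add_le (sub_nonneg.2 hv₂.le) (sub_nonneg.2 hv₁.le) dist_nonneg
    (hsv.trans (by ring))
  have hL := walkLength_le_of_subset_canonicalPath hP hq he
  rw [← Subtype.dist_eq] at ha hb
  rcases abs_cases (coord (i + 2) v - coord (i + 1) v - (coord (i + 2) c - coord (i + 1) c : ℝ))
    with ⟨h, -⟩ | ⟨h, -⟩ <;> constructor <;> linarith

lemma IsApproximationPath.walkLength_le (hP : GeneralPosition P) (hv : v ∈ negNbrs P s i)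
    {p : (G9 P).Walk s v} (hp : IsApproximationPath P i p) :
    walkLength p ≤ 3 * dist s v ∧ walkLength p.tail ≤ 2 * dist s v := by
  obtain ⟨c, h, q, rfl, hc, hq, he⟩ := hp
  have htail : walkLength (Walk.cons h q).tail = walkLength q := by
    simp [walkLength]
  rw [walkLength_cons, htail]
  exact hc.dist_add_walkLength_le hP hv hq he

lemma exists_walkLength_le_of_adj (hP : GeneralPosition P) (h : (halfTheta6 P).Adj v w) :
    ∃ p : (G9 P).Walk v w, walkLength p ≤ 3 * dist v w := by
  obtain ⟨i, hw | hv⟩ := exists_mem_negNbrs_or_mem_negNbrs h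
  · obtain ⟨p, hp⟩ := exists_isApproximationPath hP hw
    exact ⟨p, (hp.walkLength_le hP hw).1⟩
  · obtain ⟨p, hp⟩ := exists_isApproximationPath hP hv
    refine ⟨p.reverse, ?_⟩
    rw [walkLength_reverse, dist_comm]
    exact (hp.walkLength_le hP hv).1

end ApproximationPath

end HalfTheta

theorem mainTheorem7 (P : Finset HalfTheta.Plane) (hP : HalfTheta.GeneralPosition P) :
    HalfTheta.IsSpanner 3 (HalfTheta.G9 P) (HalfTheta.halfTheta6 P) ∧
    ∀ (s v : P) (i : Fin 3), (HalfTheta.halfTheta6 P).Adj s v →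
      v.1 ∈ HalfTheta.sector (HalfTheta.negIdx i) s →
      (∃ p : (HalfTheta.G9 P).Walk s v, HalfTheta.IsApproximationPath P i p) ∧
      ∀ p : (HalfTheta.G9 P).Walk s v, HalfTheta.IsApproximationPath P i p →
        HalfTheta.walkLength p ≤ 3 * dist s v ∧
        HalfTheta.walkLength p.tail ≤ 2 * dist s v := by
  have hadj : ∀ u v, (HalfTheta.halfTheta6 P).Adj u v →
      ∃ p : (HalfTheta.G9 P).Walk u v, HalfTheta.walkLength p ≤ 3 * dist u v :=
    fun _ _ => HalfTheta.exists_walkLength_le_of_adj hP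
  refine ⟨HalfTheta.isSpanner_of_forall_adj (by norm_num) HalfTheta.G9_le_halfTheta6 hadj,
    fun s v i hsv hv => ?_⟩
  have hmem : v ∈ HalfTheta.negNbrs P s i := ⟨hsv, hv⟩
  exact ⟨HalfTheta.exists_isApproximationPath hP hmem, fun p hp => hp.walkLength_le hP hmem⟩
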